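/- Let $(\mathscr V,\otimes,\Bbbk)$ be a closed symmetric monoidal category that is also equipped with a model structure. (Only finite limits and colimits are required of a model category, and factorizations need not be functorial.) For an algebra (monoid) $A$ in $\mathscr V$, let $\mathscr V_A$ and ${}_A\mathscr V$ be the categories of right and left $A$-modules. Assume the following. (a) For every algebra $A$ in $\mathscr V$, the category $\mathscr V_A$ is equipped with a model structure whose weak equivalences are created by the forgetful functor to $\mathscr V$ (a morphism of modules is a weak equivalence if and only if its underlying morphism in $\mathscr V$ is), and ${}_A\mathscr V$ likewise admits a model structure whose weak equivalences are created in $\mathscr V$. (b) (CHF hypothesis) For every algebra $A$, every cofibrant right $A$-module $M$ is homotopy flat, i.e., the functor $M\otimes_A-\colon {}_A\mathscr V\to\mathscr V$ preserves weak equivalences. Let $A$ and $B$ be algebras in $\mathscr V$ and let ${}_AX_B$ be an $A$-$B$-bimodule. For a right $B$-module $N$, let $\operatorname{Map}_B(X,N)$ be the equalizer of the two maps $\operatorname{Map}(X,N)\rightrightarrows\operatorname{Map}(X\otimes B,N)$ induced by the right $B$-actions on $X$ and on $N$, with the right $A$-module structure coming from the left $A$-action on $X$. This gives an adjunction $$-\otimes_A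 X\colon \mathscr V_A\rightleftarrows\mathscr V_B\colon \operatorname{Map}_B(X,-).$$ Suppose that it is a Quillen adjunction (the left adjoint preserves cofibrations and trivial cofibrations), that $B$ is fibrant in $\mathscr V_B$, and that $X$ is fibrant and cofibrant as a right $B$-module. Then the adjunction is a Quillen equivalence (for every cofibrant $M$ in $\mathscr V_A$ and every fibrant $N$ in $\mathscr V_B$, a map $M\otimes_AX\to N$ is a weak equivalence if and only if its adjoint $M\to\operatorname{Map}_B(X,N)$ is) if and only if the following three conditions hold: 1. the map $\eta_A\colon A\to\operatorname{Map}_B(X,X)$, adjoint to the canonical isomorphism $A\otimes_AX\cong X$, is a weak equivalence; 2. $X$ is homotopy cofaithful as a right $B$-module in the sense that the functor $\operatorname{Map}_B(X,-)$ reflects weak equivalences between fibrant right $B$-modules; 3. $X$ is homotopy right dualizable, i.e., the canonical map $$\ell_N\colon N\otimes_B\operatorname{Map}_B(X,B)\to\operatorname{Map}_B(X,N),$$ adjoint to $N\otimes_B\operatorname{Map}_B(X,B)\otimes_AX\xrightarrow{1\otimes \mathrm{ev}}N\otimes_BB\cong N$, is a weak equivalence for all fibrant and cofibrant right $B$-modules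 $N$. -/

import Mathlib

open CategoryTheory CategoryTheory.Limits MonoidalCategory MonObj HomotopicalAlgebra

universe v u

namespace HomotopicalMorita

set_option linter.unusedSectionVars false

section Closed

variable {V : Type u} [Category.{v} V] [MonoidalCategory V] [SymmetricCategory V]
  [MonoidalClosed V]

instance preservesColimits_tensorRight (X : V) :
    PreservesColimitsOfSize.{0, 0} (tensorRight X) :=
  preservesColimits_of_natIso (BraidedCategory.tensorLeftIsoTensorRight X)

/-- Evaluation `Map(X, N) ⊗ X ⟶ N` for the internal hom. -/
noncomputable def evR (X N : V) : (ihom X).obj N ⊗ X ⟶ N :=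
  (β_ _ _).hom ≫ (ihom.ev X).app N

/-- The transpose `Y ⟶ Map(X, N)` of `f : Y ⊗ X ⟶ N`. -/
noncomputable def curryR {X Y N : V} (f : Y ⊗ X ⟶ N) : Y ⟶ (ihom X).obj N :=
  MonoidalClosed.curry ((β_ X Y).hom ≫ f)

@[simp]
lemma curryR_evR {X Y N : V} (f : Y ⊗ X ⟶ N) : curryR f ▷ X ≫ evR X N = f := by
  have h : X ◁ curryR f ≫ (ihom.ev X).app N = (β_ X Y).hom ≫ f := by
    rw [← MonoidalClosed.uncurry_eq, curryR, MonoidalClosed.uncurry_curry]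
  rw [evR, BraidedCategory.braiding_naturality_left_assoc, h, SymmetricCategory.symmetry_assoc]

lemma hom_ext_evR {X Y N : V} {f g : Y ⟶ (ihom X).obj N}
    (h : f ▷ X ≫ evR X N = g ▷ X ≫ evR X N) : f = g := by
  apply MonoidalClosed.uncurry_injective
  rw [evR, BraidedCategory.braiding_naturality_left_assoc,
    BraidedCategory.braiding_naturality_left_assoc, cancel_epi] at h
  rw [MonoidalClosed.uncurry_eq, MonoidalClosed.uncurry_eq, h]

end Closed

section Map

variable {V : Type u} [Category.{v} V] [MonoidalCategory V] [SymmetricCategory V]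
  [MonoidalClosed V] [HasEqualizers V] {A B C : Mon V}

/-- The map `Map(X, N) ⟶ Map(X ⊗ B, N)` induced by the right action of `B` on `X`. -/
noncomputable def mapTop (X : Bimod A B) (N : Bimod C B) :
    (ihom X.X).obj N.X ⟶ (ihom (X.X ⊗ B.X)).obj N.X :=
  curryR ((ihom X.X).obj N.X ◁ X.actRight ≫ evR X.X N.X)

/-- The map `Map(X, N) ⟶ Map(X ⊗ B, N ⊗ B) ⟶ Map(X ⊗ B, N)`, where the first arrow is `- ⊗ B`
and the second one is induced by the right action of `B` on `N`. -/
noncomputable def mapBot (X : Bimod A B) (N : Bimod C B) :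
    (ihom X.X).obj N.X ⟶ (ihom (X.X ⊗ B.X)).obj N.X :=
  curryR ((α_ _ _ _).inv ≫ evR X.X N.X ▷ B.X ≫ N.actRight)

/-- The object of `V` underlying `Map_B(X, N)`. -/
noncomputable def mapObj (X : Bimod A B) (N : Bimod C B) : V :=
  equalizer (mapTop X N) (mapBot X N)

/-- The inclusion `Map_B(X, N) ⟶ Map(X, N)`. -/
noncomputable def mapι (X : Bimod A B) (N : Bimod C B) : mapObj X N ⟶ (ihom X.X).obj N.X :=
  equalizer.ι (mapTop X N) (mapBot X N)

/-- The evaluation `Map_B(X, N) ⊗ X ⟶ N`. -/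
noncomputable def mapEvAux (X : Bimod A B) (N : Bimod C B) : mapObj X N ⊗ X.X ⟶ N.X :=
  mapι X N ▷ X.X ≫ evR X.X N.X

variable {X : Bimod A B} {N : Bimod C B}

/-- `B`-linearity (in the second variable) of a map `K ⊗ X ⟶ N`. -/
def IsBLinear (X : Bimod A B) (N : Bimod C B) {K : V} (g : K ⊗ X.X ⟶ N.X) : Prop :=
  K ◁ X.actRight ≫ g = (α_ K X.X B.X).inv ≫ g ▷ B.X ≫ N.actRight

lemma mapTop_eq_iff {K : V} (f : K ⟶ (ihom X.X).obj N.X) :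
    f ≫ mapTop X N = f ≫ mapBot X N ↔ IsBLinear X N (f ▷ X.X ≫ evR X.X N.X) := by
  have h1 : (f ≫ mapTop X N) ▷ (X.X ⊗ B.X) ≫ evR (X.X ⊗ B.X) N.X =
      K ◁ X.actRight ≫ f ▷ X.X ≫ evR X.X N.X := by
    rw [comp_whiskerRight, Category.assoc, mapTop, curryR_evR, whisker_exchange_assoc]
  have h2 : (f ≫ mapBot X N) ▷ (X.X ⊗ B.X) ≫ evR (X.X ⊗ B.X) N.X =
      (α_ K X.X B.X).inv ≫ (f ▷ X.X ≫ evR X.X N.X) ▷ B.X ≫ N.actRight := by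
    rw [comp_whiskerRight, Category.assoc, mapBot, curryR_evR, comp_whiskerRight, Category.assoc,
      associator_inv_naturality_left_assoc]
  refine ⟨fun h => ?_, fun h => hom_ext_evR ?_⟩
  · rw [IsBLinear, ← h1, ← h2, h]
  · rw [h1, h2, h]

lemma isBLinear_mapEvAux (X : Bimod A B) (N : Bimod C B) : IsBLinear X N (mapEvAux X N) :=
  (mapTop_eq_iff _).1 (equalizer.condition _ _)

/-- The transpose `K ⟶ Map_B(X, N)` of a `B`-linear map `K ⊗ X ⟶ N`. -/
noncomputable def mapLiftAux {K : V} (g : K ⊗ X.X ⟶ N.X) (hg : IsBLinear X N g) :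
    K ⟶ mapObj X N :=
  equalizer.lift (curryR g) ((mapTop_eq_iff _).2 (by rwa [curryR_evR]))

lemma mapLiftAux_ι {K : V} (g : K ⊗ X.X ⟶ N.X) (hg : IsBLinear X N g) :
    mapLiftAux g hg ≫ mapι X N = curryR g :=
  equalizer.lift_ι _ _

lemma mapLiftAux_ev {K : V} (g : K ⊗ X.X ⟶ N.X) (hg : IsBLinear X N g) :
    mapLiftAux g hg ▷ X.X ≫ mapEvAux X N = g := by
  rw [mapEvAux, ← comp_whiskerRight_assoc, mapLiftAux_ι, curryR_evR]

lemma mapObj_hom_ext {K : V} {f g : K ⟶ mapObj X N}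
    (h : f ▷ X.X ≫ mapEvAux X N = g ▷ X.X ≫ mapEvAux X N) : f = g := by
  have h' : f ≫ mapι X N = g ≫ mapι X N := hom_ext_evR (by simpa [mapEvAux] using h)
  exact equalizer.hom_ext h'

variable (X N)

lemma isBLinear_left : IsBLinear X N
    ((α_ C.X (mapObj X N) X.X).hom ≫ C.X ◁ mapEvAux X N ≫ N.actLeft) := by
  have h := isBLinear_mapEvAux X N
  unfold IsBLinear at h ⊢
  rw [associator_naturality_right_assoc, ← MonoidalCategory.whiskerLeft_comp_assoc, h]
  simp only [MonoidalCategory.whiskerLeft_comp, comp_whiskerRight, Category.assoc,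
    Bimod.middle_assoc, whisker_assoc, Iso.inv_hom_id_assoc]
  monoidal

lemma isBLinear_right : IsBLinear X N
    ((α_ (mapObj X N) A.X X.X).hom ≫ mapObj X N ◁ X.actLeft ≫ mapEvAux X N) := by
  have h := isBLinear_mapEvAux X N
  have h' : mapEvAux X N ▷ B.X ≫ N.actRight =
      (α_ _ _ _).hom ≫ mapObj X N ◁ X.actRight ≫ mapEvAux X N := by
    rw [h, Iso.hom_inv_id_assoc]
  unfold IsBLinear
  simp only [comp_whiskerRight, Category.assoc, whisker_assoc, h', Iso.inv_hom_id_assoc,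
    associator_naturality_right_assoc]
  rw [← MonoidalCategory.whiskerLeft_comp_assoc (mapObj X N) (X.actLeft ▷ B.X), X.middle_assoc]
  simp only [MonoidalCategory.whiskerLeft_comp, Category.assoc]
  monoidal

/-- The left action of `C` on `Map_B(X, N)`. -/
noncomputable def mapActLeft : C.X ⊗ mapObj X N ⟶ mapObj X N :=
  mapLiftAux _ (isBLinear_left X N)

/-- The right action of `A` on `Map_B(X, N)`. -/
noncomputable def mapActRight : mapObj X N ⊗ A.X ⟶ mapObj X N :=
  mapLiftAux _ (isBLinear_right X N)

lemma mapActLeft_ev : mapActLeft X N ▷ X.X ≫ mapEvAux X N =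
    (α_ C.X (mapObj X N) X.X).hom ≫ C.X ◁ mapEvAux X N ≫ N.actLeft :=
  mapLiftAux_ev _ _

lemma mapActRight_ev : mapActRight X N ▷ X.X ≫ mapEvAux X N =
    (α_ (mapObj X N) A.X X.X).hom ≫ mapObj X N ◁ X.actLeft ≫ mapEvAux X N :=
  mapLiftAux_ev _ _

/-- `Map_B(X, N)` as a `C`-`A`-bimodule. The left action of `C` comes from `N`, the right action of
`A` comes from the left action on `X`. -/
noncomputable def mapBimod : Bimod C A where
  X := mapObj X N
  actLeft := mapActLeft X N
  actRight := mapActRight X N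
  one_actLeft := by
    apply mapObj_hom_ext
    rw [comp_whiskerRight, Category.assoc, mapActLeft_ev, associator_naturality_left_assoc,
      ← whisker_exchange_assoc, N.one_actLeft]
    monoidal
  left_assoc := by
    apply mapObj_hom_ext
    simp only [comp_whiskerRight, Category.assoc, mapActLeft_ev, whisker_assoc,
      associator_naturality_left_assoc, Iso.inv_hom_id_assoc]
    rw [← whisker_exchange_assoc, N.left_assoc, ← MonoidalCategory.whiskerLeft_comp_assoc
      C.X (mapActLeft X N ▷ X.X), mapActLeft_ev]
    monoidal
  actRight_one := by
    apply mapObj_hom_ext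
    simp only [comp_whiskerRight, Category.assoc, mapActRight_ev, whisker_assoc,
      Iso.inv_hom_id_assoc]
    rw [← MonoidalCategory.whiskerLeft_comp_assoc, X.one_actLeft]
    monoidal
  right_assoc := by
    apply mapObj_hom_ext
    simp only [comp_whiskerRight, Category.assoc, mapActRight_ev, whisker_assoc,
      Iso.inv_hom_id_assoc, associator_naturality_left_assoc]
    rw [← MonoidalCategory.whiskerLeft_comp_assoc, X.left_assoc, ← whisker_exchange_assoc,
      mapActRight_ev]
    simp only [MonoidalCategory.whiskerLeft_comp, Category.assoc]
    monoidal
  middle_assoc := by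
    apply mapObj_hom_ext
    simp only [comp_whiskerRight, Category.assoc, mapActRight_ev, mapActLeft_ev, whisker_assoc,
      Iso.inv_hom_id_assoc, associator_naturality_left_assoc]
    rw [← whisker_exchange_assoc, mapActLeft_ev, ← MonoidalCategory.whiskerLeft_comp_assoc
      C.X (mapActRight X N ▷ X.X), mapActRight_ev]
    simp only [MonoidalCategory.whiskerLeft_comp, Category.assoc]
    monoidal

/-- The evaluation `Map_B(X, N) ⊗ X ⟶ N`. -/
noncomputable def mapEv (X : Bimod A B) (N : Bimod C B) : (mapBimod X N).X ⊗ X.X ⟶ N.X :=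
  mapEvAux X N

variable {X N}

/-- The transpose `K ⟶ Map_B(X, N)` of a `B`-linear map `K ⊗ X ⟶ N`. -/
noncomputable def mapLift {K : V} (g : K ⊗ X.X ⟶ N.X) (hg : IsBLinear X N g) :
    K ⟶ (mapBimod X N).X :=
  mapLiftAux g hg

lemma mapLift_ev {K : V} (g : K ⊗ X.X ⟶ N.X) (hg : IsBLinear X N g) :
    mapLift g hg ▷ X.X ≫ mapEv X N = g :=
  mapLiftAux_ev g hg

lemma map_hom_ext {K : V} {f g : K ⟶ (mapBimod X N).X}
    (h : f ▷ X.X ≫ mapEv X N = g ▷ X.X ≫ mapEv X N) : f = g :=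
  mapObj_hom_ext h

variable (X N)

lemma mapEv_actRight : (mapBimod X N).X ◁ X.actRight ≫ mapEv X N =
    (α_ _ _ _).inv ≫ mapEv X N ▷ B.X ≫ N.actRight :=
  isBLinear_mapEvAux X N

lemma actLeft_mapEv : (mapBimod X N).actLeft ▷ X.X ≫ mapEv X N =
    (α_ _ _ _).hom ≫ C.X ◁ mapEv X N ≫ N.actLeft :=
  mapActLeft_ev X N

lemma actRight_mapEv : (mapBimod X N).actRight ▷ X.X ≫ mapEv X N =
    (α_ _ _ _).hom ≫ (mapBimod X N).X ◁ X.actLeft ≫ mapEv X N :=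
  mapActRight_ev X N

variable {N}

lemma isBLinear_mapEv_comp {N N' : Bimod C B} (f : N ⟶ N') :
    IsBLinear X N' (mapEv X N ≫ f.hom) := by
  unfold IsBLinear
  rw [← Category.assoc, mapEv_actRight, Category.assoc, Category.assoc, f.right_act_hom,
    comp_whiskerRight, Category.assoc]

/-- The map `Map_B(X, N) ⟶ Map_B(X, N')` induced by `f : N ⟶ N'`. -/
noncomputable def mapMap {N N' : Bimod C B} (f : N ⟶ N') : mapBimod X N ⟶ mapBimod X N' where
  hom := mapLift (mapEv X N ≫ f.hom) (isBLinear_mapEv_comp X f)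
  left_act_hom := by
    apply map_hom_ext
    rw [comp_whiskerRight, Category.assoc, mapLift_ev, ← Category.assoc, actLeft_mapEv,
      comp_whiskerRight, Category.assoc, Category.assoc, Category.assoc, actLeft_mapEv,
      whisker_assoc]
    simp only [Category.assoc, Iso.inv_hom_id_assoc]
    rw [← MonoidalCategory.whiskerLeft_comp_assoc, mapLift_ev, f.left_act_hom,
      MonoidalCategory.whiskerLeft_comp_assoc]
  right_act_hom := by
    apply map_hom_ext
    rw [comp_whiskerRight, Category.assoc, mapLift_ev, ← Category.assoc, actRight_mapEv,
      comp_whiskerRight, Category.assoc, Category.assoc, Category.assoc, actRight_mapEv,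
      associator_naturality_left_assoc, ← whisker_exchange_assoc, mapLift_ev]

lemma mapMap_ev {N N' : Bimod C B} (f : N ⟶ N') :
    (mapMap X f).hom ▷ X.X ≫ mapEv X N' = mapEv X N ≫ f.hom :=
  mapLift_ev _ (isBLinear_mapEv_comp X f)

/-- The functor `Map_B(X, -)` from `C`-`B`-bimodules to `C`-`A`-bimodules. -/
noncomputable def mapFunctor : Bimod C B ⥤ Bimod C A where
  obj N := mapBimod X N
  map f := mapMap X f
  map_id N := by
    apply Bimod.hom_ext
    apply map_hom_ext
    rw [mapMap_ev, Bimod.id_hom', Bimod.id_hom', id_whiskerRight, Category.id_comp,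
      Category.comp_id]
  map_comp f g := by
    apply Bimod.hom_ext
    apply map_hom_ext
    rw [mapMap_ev, Bimod.comp_hom', Bimod.comp_hom', comp_whiskerRight, Category.assoc, mapMap_ev,
      ← Category.assoc, ← Category.assoc, mapMap_ev]

end Map

section Tensor

variable {V : Type u} [Category.{v} V] [MonoidalCategory V] [SymmetricCategory V]
  [MonoidalClosed V] [HasCoequalizers V] {A B C : Mon V}

/-- The functor `- ⊗_A X` from `C`-`A`-bimodules to `C`-`B`-bimodules. -/
noncomputable def tensorFunctor (X : Bimod A B) : Bimod C A ⥤ Bimod C B where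
  obj M := M.tensorBimod X
  map f := Bimod.whiskerRight f X
  map_id _ := Bimod.id_whiskerRight_bimod
  map_comp f g := Bimod.comp_whiskerRight_bimod f g X

/-- The projection `M ⊗ X ⟶ M ⊗_A X`. -/
noncomputable def tensorπ (M : Bimod C A) (X : Bimod A B) :
    M.X ⊗ X.X ⟶ (M.tensorBimod X).X :=
  coequalizer.π (M.actRight ▷ X.X) ((α_ _ _ _).hom ≫ (M.X ◁ X.actLeft))

variable (M : Bimod C A) (X : Bimod A B) (N : Bimod C B)

lemma tensorπ_condition : M.actRight ▷ X.X ≫ tensorπ M X =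
    (α_ _ _ _).hom ≫ M.X ◁ X.actLeft ≫ tensorπ M X :=
  (coequalizer.condition (M.actRight ▷ X.X) ((α_ _ _ _).hom ≫ (M.X ◁ X.actLeft))).trans
    (Category.assoc _ _ _)

lemma tensorπ_actLeft : C.X ◁ tensorπ M X ≫ (M.tensorBimod X).actLeft =
    (α_ _ _ _).inv ≫ M.actLeft ▷ X.X ≫ tensorπ M X :=
  Bimod.TensorBimod.whiskerLeft_π_actLeft M X

lemma tensorπ_actRight : tensorπ M X ▷ B.X ≫ (M.tensorBimod X).actRight =
    (α_ _ _ _).hom ≫ M.X ◁ X.actRight ≫ tensorπ M X :=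
  Bimod.TensorBimod.π_tensor_id_actRight M X

variable {M X N}

lemma tensor_hom_ext {Z : V} {f g : (M.tensorBimod X).X ⟶ Z}
    (h : tensorπ M X ≫ f = tensorπ M X ≫ g) : f = g :=
  coequalizer.hom_ext h

instance epi_whiskerLeft_tensorπ (W : V) : Epi (W ◁ tensorπ M X) :=
  inferInstanceAs (Epi ((tensorLeft W).map (coequalizer.π (M.actRight ▷ X.X)
    ((α_ _ _ _).hom ≫ (M.X ◁ X.actLeft)))))

instance epi_whiskerRight_tensorπ (W : V) : Epi (tensorπ M X ▷ W) :=
  inferInstanceAs (Epi ((tensorRight W).map (coequalizer.π (M.actRight ▷ X.X)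
    ((α_ _ _ _).hom ≫ (M.X ◁ X.actLeft)))))

/-- The map `M ⊗_A X ⟶ Z` induced by a map `M ⊗ X ⟶ Z` that is balanced over `A`. -/
noncomputable def tensorDesc {Z : V} (k : M.X ⊗ X.X ⟶ Z)
    (hk : M.actRight ▷ X.X ≫ k = (α_ _ _ _).hom ≫ M.X ◁ X.actLeft ≫ k) :
    (M.tensorBimod X).X ⟶ Z :=
  coequalizer.desc k (by rw [hk, Category.assoc])

lemma tensorπ_desc {Z : V} (k : M.X ⊗ X.X ⟶ Z)
    (hk : M.actRight ▷ X.X ≫ k = (α_ _ _ _).hom ≫ M.X ◁ X.actLeft ≫ k) :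
    tensorπ M X ≫ tensorDesc k hk = k :=
  coequalizer.π_desc _ _

lemma tensorπ_whiskerRight {M' : Bimod C A} (f : M ⟶ M') :
    tensorπ M X ≫ (Bimod.whiskerRight f X).hom = f.hom ▷ X.X ≫ tensorπ M' X :=
  ι_colimMap _ _

variable [HasEqualizers V]

lemma isBLinear_tensorπ_comp (f : M.tensorBimod X ⟶ N) : IsBLinear X N (tensorπ M X ≫ f.hom) := by
  unfold IsBLinear
  rw [comp_whiskerRight, Category.assoc, ← f.right_act_hom, ← Category.assoc (tensorπ M X ▷ B.X),
    tensorπ_actRight]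
  simp only [Category.assoc, Iso.inv_hom_id_assoc]

/-- The transpose `M ⟶ Map_B(X, N)` of a bimodule map `M ⊗_A X ⟶ N`. -/
noncomputable def transpose (f : M.tensorBimod X ⟶ N) : M ⟶ mapBimod X N where
  hom := mapLift (tensorπ M X ≫ f.hom) (isBLinear_tensorπ_comp f)
  left_act_hom := by
    apply map_hom_ext
    rw [comp_whiskerRight, Category.assoc, mapLift_ev, comp_whiskerRight, Category.assoc,
      actLeft_mapEv, whisker_assoc]
    simp only [Category.assoc, Iso.inv_hom_id_assoc]
    rw [← MonoidalCategory.whiskerLeft_comp_assoc, mapLift_ev, MonoidalCategory.whiskerLeft_comp,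
      Category.assoc, ← f.left_act_hom, ← Category.assoc (C.X ◁ tensorπ M X), tensorπ_actLeft]
    simp only [Category.assoc, Iso.hom_inv_id_assoc]
  right_act_hom := by
    apply map_hom_ext
    rw [comp_whiskerRight, Category.assoc, mapLift_ev, comp_whiskerRight, Category.assoc,
      actRight_mapEv, associator_naturality_left_assoc, ← whisker_exchange_assoc, mapLift_ev,
      ← Category.assoc, tensorπ_condition]
    simp only [Category.assoc]

lemma transpose_ev (f : M.tensorBimod X ⟶ N) :
    (transpose f).hom ▷ X.X ≫ mapEv X N = tensorπ M X ≫ f.hom :=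
  mapLift_ev _ (isBLinear_tensorπ_comp f)

lemma balanced_mapEv (g : M ⟶ mapBimod X N) :
    M.actRight ▷ X.X ≫ g.hom ▷ X.X ≫ mapEv X N =
      (α_ _ _ _).hom ≫ M.X ◁ X.actLeft ≫ g.hom ▷ X.X ≫ mapEv X N := by
  rw [← comp_whiskerRight_assoc, g.right_act_hom, comp_whiskerRight, Category.assoc,
    actRight_mapEv, associator_naturality_left_assoc, ← whisker_exchange_assoc]

/-- The transpose `M ⊗_A X ⟶ N` of a bimodule map `M ⟶ Map_B(X, N)`. -/
noncomputable def untranspose (g : M ⟶ mapBimod X N) : M.tensorBimod X ⟶ N where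
  hom := tensorDesc (g.hom ▷ X.X ≫ mapEv X N) (balanced_mapEv g)
  left_act_hom := by
    rw [← cancel_epi (C.X ◁ tensorπ M X), ← Category.assoc, tensorπ_actLeft,
      ← MonoidalCategory.whiskerLeft_comp_assoc, tensorπ_desc, Category.assoc, Category.assoc,
      tensorπ_desc, ← comp_whiskerRight_assoc, g.left_act_hom, comp_whiskerRight, Category.assoc,
      actLeft_mapEv, whisker_assoc]
    simp only [Category.assoc, Iso.inv_hom_id_assoc, MonoidalCategory.whiskerLeft_comp]
  right_act_hom := by
    rw [← cancel_epi (tensorπ M X ▷ B.X), ← Category.assoc, tensorπ_actRight,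
      ← comp_whiskerRight_assoc (tensorπ M X), tensorπ_desc, Category.assoc, Category.assoc,
      tensorπ_desc, whisker_exchange_assoc, mapEv_actRight, comp_whiskerRight]
    simp

lemma tensorπ_untranspose (g : M ⟶ mapBimod X N) :
    tensorπ M X ≫ (untranspose g).hom = g.hom ▷ X.X ≫ mapEv X N :=
  tensorπ_desc _ (balanced_mapEv g)

/-- The bijection between bimodule maps `M ⊗_A X ⟶ N` and bimodule maps `M ⟶ Map_B(X, N)`. -/
noncomputable def transposeEquiv (M : Bimod C A) (X : Bimod A B) (N : Bimod C B) :
    (M.tensorBimod X ⟶ N) ≃ (M ⟶ mapBimod X N) where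
  toFun := transpose
  invFun := untranspose
  left_inv f := by
    apply Bimod.hom_ext
    apply tensor_hom_ext
    rw [tensorπ_untranspose, transpose_ev]
  right_inv g := by
    apply Bimod.hom_ext
    apply map_hom_ext
    rw [transpose_ev, tensorπ_untranspose]

lemma untranspose_comp {M' : Bimod C A} (f : M' ⟶ M) (g : M ⟶ mapBimod X N) :
    untranspose (f ≫ g) = Bimod.whiskerRight f X ≫ untranspose g := by
  apply Bimod.hom_ext
  apply tensor_hom_ext
  rw [tensorπ_untranspose, Bimod.comp_hom', Bimod.comp_hom', ← Category.assoc,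
    tensorπ_whiskerRight, Category.assoc, tensorπ_untranspose, comp_whiskerRight, Category.assoc]

lemma transpose_comp {N' : Bimod C B} (f : M.tensorBimod X ⟶ N) (g : N ⟶ N') :
    transpose (f ≫ g) = transpose f ≫ mapMap X g := by
  apply Bimod.hom_ext
  apply map_hom_ext
  rw [transpose_ev, Bimod.comp_hom', Bimod.comp_hom', comp_whiskerRight, Category.assoc, mapMap_ev,
    ← Category.assoc (_ ▷ _), transpose_ev, Category.assoc]

/-- The adjunction `- ⊗_A X ⊣ Map_B(X, -)` between `C`-`A`-bimodules and `C`-`B`-bimodules. -/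
noncomputable def tensorMapAdj (X : Bimod A B) :
    tensorFunctor (C := C) X ⊣ mapFunctor (C := C) X :=
  Adjunction.mkOfHomEquiv
    { homEquiv := fun M N => transposeEquiv M X N
      homEquiv_naturality_left_symm := fun f g => untranspose_comp f g
      homEquiv_naturality_right := fun f g => transpose_comp f g }

end Tensor

section Modules

variable {V : Type u} [Category.{v} V] [MonoidalCategory V]

/-- The category `V_A` of right modules over an algebra `A`. A right `A`-module is the same thing as
a `𝟙_ V`-`A`-bimodule, because the left action of the unit object is necessarily the left unitor:
see `RightMod.ofAction`, `RightMod.actLeft_eq` and `RightMod.homMk`. -/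
abbrev RightMod (A : Mon V) : Type (max u v) := Bimod (Mon.trivial V) A

/-- The category of left modules over an algebra `A`, i.e. of `A`-`𝟙_ V`-bimodules. -/
abbrev LeftMod (A : Mon V) : Type (max u v) := Bimod A (Mon.trivial V)

/-- The right `A`-module given by an object with a right action of `A`. -/
def RightMod.ofAction {A : Mon V} (M : V) (ρ : M ⊗ A.X ⟶ M)
    (hone : M ◁ η[A.X] ≫ ρ = (ρ_ M).hom)
    (hmul : M ◁ μ[A.X] ≫ ρ = (α_ M A.X A.X).inv ≫ ρ ▷ A.X ≫ ρ) : RightMod A where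
  X := M
  actLeft := (λ_ M).hom
  one_actLeft := by
    change 𝟙 (𝟙_ V) ▷ M ≫ _ = _
    simp
  left_assoc := by
    change (λ_ (𝟙_ V)).hom ▷ M ≫ _ = (α_ (𝟙_ V) (𝟙_ V) M).hom ≫ 𝟙_ V ◁ _ ≫ _
    monoidal
  actRight := ρ
  actRight_one := hone
  right_assoc := hmul
  middle_assoc := by
    change (λ_ M).hom ▷ A.X ≫ ρ = (α_ (𝟙_ V) M A.X).hom ≫ 𝟙_ V ◁ ρ ≫ (λ_ M).hom
    simp

lemma RightMod.actLeft_eq {A : Mon V} (M : RightMod A) : M.actLeft = (λ_ M.X).hom :=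
  (Category.id_comp M.actLeft).symm.trans
    ((congrArg (fun k => k ≫ M.actLeft) (id_whiskerRight (𝟙_ V) M.X).symm).trans M.one_actLeft)

/-- A map that commutes with the right actions is a morphism of right modules. -/
def RightMod.homMk {A : Mon V} {M N : RightMod A} (f : M.X ⟶ N.X)
    (hf : M.actRight ≫ f = f ▷ A.X ≫ N.actRight) : M ⟶ N where
  hom := f
  left_act_hom := by
    rw [M.actLeft_eq, N.actLeft_eq]
    exact (leftUnitor_naturality f).symm
  right_act_hom := hf

/-- The right `B`-module underlying an `A`-`B`-bimodule. -/
def rightPart {A B : Mon V} (X : Bimod A B) : RightMod B :=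
  RightMod.ofAction X.X X.actRight X.actRight_one X.right_assoc

end Modules

section Quillen

variable {M : Type*} [Category* M] {N : Type*} [Category* N]
  [ModelCategory M] [ModelCategory N] {F : M ⥤ N} {G : N ⥤ M}

/-- An adjunction between model categories is a Quillen adjunction if the left adjoint preserves
cofibrations and trivial cofibrations. -/
structure IsQuillenAdjunction (_adj : F ⊣ G) : Prop where
  map_cofibration : ∀ {K L : M} (i : K ⟶ L), Cofibration i → Cofibration (F.map i)
  map_trivialCofibration : ∀ {K L : M} (i : K ⟶ L), Cofibration i → WeakEquivalence i →
    WeakEquivalence (F.map i)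

/-- A Quillen adjunction is a Quillen equivalence if for every cofibrant `K` and every fibrant `L`,
a map `F K ⟶ L` is a weak equivalence if and only if its adjoint `K ⟶ G L` is one. -/
structure IsQuillenEquivalence (adj : F ⊣ G) : Prop extends IsQuillenAdjunction adj where
  weakEquivalence_iff : ∀ {K : M} {L : N}, IsCofibrant K → IsFibrant L → ∀ f : F.obj K ⟶ L,
    WeakEquivalence f ↔ WeakEquivalence (adj.homEquiv K L f)

end Quillen

section Homotopy

variable (V : Type u) [Category.{v} V] [MonoidalCategory V] [SymmetricCategory V]
  [MonoidalClosed V] [ModelCategory V] [∀ A : Mon V, ModelCategory (RightMod A)]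

/-- For every algebra `A`, the forgetful functor creates the weak equivalences of the given model
structure on right `A`-modules, and left `A`-modules admit a model structure whose weak equivalences
are created by the forgetful functor. -/
structure ModuleHypothesis : Prop where
  right : ∀ (A : Mon V) {M N : RightMod A} (f : M ⟶ N),
    WeakEquivalence f ↔ WeakEquivalence f.hom
  left : ∀ A : Mon V, ∃ _ : ModelCategory (LeftMod A), ∀ {M N : LeftMod A} (f : M ⟶ N),
    WeakEquivalence f ↔ WeakEquivalence f.hom

variable {V} in
/-- A right `A`-module `M` is homotopy flat if `M ⊗_A -`, from left `A`-modules to `V`, preserves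
weak equivalences. (The weak equivalences of left `A`-modules are created in `V`.) -/
def HomotopyFlat {A : Mon V} (M : RightMod A) : Prop :=
  ∀ {P Q : LeftMod A} (f : P ⟶ Q), WeakEquivalence f.hom →
    WeakEquivalence (Bimod.whiskerLeft M f).hom

/-- Every cofibrant right module over every algebra is homotopy flat. -/
def CHFHypothesis : Prop :=
  ∀ (A : Mon V) (M : RightMod A), IsCofibrant M → HomotopyFlat M

variable {V} {A B : Mon V} (X : Bimod A B)

/-- The adjunction `- ⊗_A X ⊣ Map_B(X, -)` between `V_A` and `V_B` governed by `X`. -/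
noncomputable def governedAdj :
    tensorFunctor (C := Mon.trivial V) X ⊣ mapFunctor (C := Mon.trivial V) X :=
  tensorMapAdj X

/-- The map `η_A : A ⟶ Map_B(X, X)` (of `A`-bimodules) adjoint to `A ⊗_A X ≅ X`. -/
noncomputable def unitMap : Bimod.regular A ⟶ mapBimod X X :=
  transpose (Bimod.leftUnitorBimod X).hom

/-- The evaluation `Map_B(X, B) ⊗_A X ⟶ B`, a map of `B`-bimodules. -/
noncomputable def dualEv :
    (mapBimod X (Bimod.regular B)).tensorBimod X ⟶ Bimod.regular B :=
  untranspose (𝟙 _)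

/-- The map `ℓ_N : N ⊗_B Map_B(X, B) ⟶ Map_B(X, N)` of right `A`-modules, adjoint to
`N ⊗_B Map_B(X, B) ⊗_A X ⟶ N ⊗_B B ≅ N`. -/
noncomputable def dualMap (N : RightMod B) :
    N.tensorBimod (mapBimod X (Bimod.regular B)) ⟶ mapBimod X N :=
  transpose ((Bimod.associatorBimod N (mapBimod X (Bimod.regular B)) X).hom ≫
    Bimod.whiskerLeft N (dualEv X) ≫ (Bimod.rightUnitorBimod N).hom)

/-- `Map_B(X, -) : V_B ⟶ V` reflects weak equivalences between fibrant objects. -/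
def HomotopyCofaithful : Prop :=
  ∀ {M N : RightMod B}, IsFibrant M → IsFibrant N → ∀ f : M ⟶ N,
    WeakEquivalence (mapMap X f).hom → WeakEquivalence f

/-- For a bimodule `X` that is fibrant and cofibrant as a right `B`-module: `ℓ_N` is a weak
equivalence for every fibrant and cofibrant right `B`-module `N`. -/
def HomotopyRightDualizable : Prop :=
  ∀ N : RightMod B, IsFibrant N → IsCofibrant N → WeakEquivalence (dualMap X N)

end Homotopy

end HomotopicalMorita

/-! Write D for Map_B(X, B). A Quillen adjunction is an equivalence once the right adjoint reflects
weak equivalences between fibrant objects and the derived unit is a weak equivalence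
(`IsQuillenAdjunction.isQuillenEquivalence`). Cofaithfulness is the first requirement.

For the second, let M be cofibrant and j : M ⊗_A X ⟶ R a trivial cofibration with R fibrant.
Everything is compared with the assembly map M ⊗_A Map_B(X, X) ⟶ Map_B(X, R). Preceded by M ⊗ ℓ_X it
becomes j ⊗ D followed by ℓ_R, so dualizability and flatness make it a weak equivalence. Preceded by
M ⊗ η_A it becomes the adjoint of j, up to M ⊗_A A ≅ M. Two-out-of-three finishes
(`weakEquivalence_transpose`).

Conversely, a Quillen equivalence is applied to cofibrant replacements of A, of Map_B(X, N) and of N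
⊗_B D. The difficulty is that Map_B(X, N) and N ⊗_B D need not be flat, so tensoring them with X is
not homotopy invariant. The derived tensor product is therefore balanced: X is resolved by a left
module Q for which - ⊗_A Q preserves weak equivalences. The CHF hypothesis concerns right modules,
so Q comes from a cofibrant right module over the opposite algebra (`exists_leftHomotopyFlat`). -/

namespace HomotopicalMorita

/-! ### Criteria for Quillen equivalences. -/

section QuillenAdjunctions

variable {M : Type*} [Category* M] {N : Type*} [Category* N]
  [ModelCategory M] [ModelCategory N] {F : M ⥤ N} {G : N ⥤ M} {adj : F ⊣ G}

lemma exists_cofibrant_replacement (K : M) :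
    ∃ (Q : M) (q : Q ⟶ K), IsCofibrant Q ∧ WeakEquivalence q := by
  let h := MorphismProperty.factorizationData (cofibrations M) (trivialFibrations M)
    (initial.to K)
  have hi : initial.to h.Z = h.i := initialIsInitial.hom_ext _ _
  exact ⟨h.Z, h.p, (cofibration_iff _).2 (hi ▸ h.hi), (weakEquivalence_iff _).2 h.hp.2⟩

lemma exists_fibrant_replacement (K : M) :
    ∃ (R : M) (j : K ⟶ R), IsFibrant R ∧ Cofibration j ∧ WeakEquivalence j := by
  let h := MorphismProperty.factorizationData (trivialCofibrations M) (fibrations M)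
    (terminal.from K)
  have hp : terminal.from h.Z = h.p := terminalIsTerminal.hom_ext _ _
  exact ⟨h.Z, h.i, (fibration_iff _).2 (hp ▸ h.hp), (cofibration_iff _).2 h.hi.1,
    (weakEquivalence_iff _).2 h.hi.2⟩

namespace IsQuillenAdjunction

lemma isCofibrant_obj (h : IsQuillenAdjunction adj) {K : M} (hK : IsCofibrant K) :
    IsCofibrant (F.obj K) := by
  have := adj.leftAdjoint_preservesColimits
  have hI : IsInitial (F.obj (⊥_ M)) := IsInitial.isInitialObj F _ initialIsInitial
  exact (isCofibrant_iff_of_isInitial (F.map (initial.to K)) hI).2 (h.map_cofibration _ hK)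

lemma map_trivialFibration (h : IsQuillenAdjunction adj) {K L : N} (p : K ⟶ L) [Fibration p]
    [WeakEquivalence p] : WeakEquivalence (G.map p) := by
  have : trivialFibrations M (G.map p) := by
    rw [← cofibrations_rlp]
    intro A B i hi
    have := h.map_cofibration i ((cofibration_iff _).2 hi)
    rw [← adj.hasLiftingProperty_iff]
    infer_instance
  exact (weakEquivalence_iff _).2 this.2

/-- Ken Brown's lemma: a right Quillen functor preserves weak equivalences between fibrant
objects. -/
lemma weakEquivalence_map (h : IsQuillenAdjunction adj) {K L : N} (f : K ⟶ L) [IsFibrant K]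
    [IsFibrant L] [WeakEquivalence f] : WeakEquivalence (G.map f) := by
  -- Here f = i ≫ p with p a trivial fibration and i a section of a trivial fibration r. The functor
  -- G preserves trivial fibrations, and two-out-of-three handles i.
  let b := Classical.arbitrary (FibrantBrownFactorization f)
  have : Fibration b.p := (fibration_iff _).2 b.hp
  have hp : WeakEquivalence (G.map b.p) := h.map_trivialFibration b.p
  have hr : WeakEquivalence (G.map b.r) := h.map_trivialFibration b.r
  have hi : WeakEquivalence (G.map b.i) :=
    weakEquivalence_of_postcomp_of_fac
      (show G.map b.i ≫ G.map b.r = 𝟙 _ by rw [← G.map_comp, b.i_r, G.map_id])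
  rw [← b.fac, G.map_comp]
  infer_instance

/-- A Quillen adjunction is a Quillen equivalence if the right adjoint reflects weak equivalences
between fibrant objects and the derived unit is a weak equivalence. -/
lemma isQuillenEquivalence (h : IsQuillenAdjunction adj)
    (hG : ∀ {K L : N}, IsFibrant K → IsFibrant L → ∀ f : K ⟶ L,
      WeakEquivalence (G.map f) → WeakEquivalence f)
    (hunit : ∀ {K : M} {R : N}, IsCofibrant K → IsFibrant R → ∀ j : F.obj K ⟶ R,
      Cofibration j → WeakEquivalence j → WeakEquivalence (adj.homEquiv K R j)) :
    IsQuillenEquivalence adj where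
  toIsQuillenAdjunction := h
  weakEquivalence_iff {K L} hK hL f := by
    -- As L is fibrant, f extends along j to some g : R ⟶ L. The adjoint of f is the adjoint of j
    -- followed by G g, so the claim reduces to comparing g with G g.
    obtain ⟨R, j, hR, hj, hj'⟩ := exists_fibrant_replacement (F.obj K)
    have sq : CommSq f j (terminal.from L) (terminal.from R) := ⟨Subsingleton.elim _ _⟩
    obtain ⟨g, hg⟩ : ∃ g : R ⟶ L, j ≫ g = f := ⟨sq.lift, sq.fac_left⟩
    have hu := hunit hK hR j hj hj'
    rw [← hg, adj.homEquiv_naturality_right, weakEquivalence_precomp_iff,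
      weakEquivalence_precomp_iff]
    exact ⟨fun _ => h.weakEquivalence_map g, hG hR hL g⟩

end IsQuillenAdjunction

/-- For a cofibrant replacement q of G K, the adjoint of q is a weak equivalence, and following it
with f gives the adjoint of q ≫ G f. Two-out-of-three then isolates f. -/
lemma IsQuillenEquivalence.reflects (h : IsQuillenEquivalence adj) {K L : N} (hK : IsFibrant K)
    (hL : IsFibrant L) (f : K ⟶ L) (hf : WeakEquivalence (G.map f)) : WeakEquivalence f := by
  obtain ⟨Q, q, hQ, hq⟩ := exists_cofibrant_replacement (G.obj K)
  have h₁ : WeakEquivalence ((adj.homEquiv Q K).symm q) := by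
    rwa [h.weakEquivalence_iff hQ hK, Equiv.apply_symm_apply]
  have h₂ : WeakEquivalence ((adj.homEquiv Q K).symm q ≫ f) := by
    rw [h.weakEquivalence_iff hQ hL, adj.homEquiv_naturality_right, Equiv.apply_symm_apply]
    infer_instance
  exact weakEquivalence_of_precomp ((adj.homEquiv Q K).symm q) f

end QuillenAdjunctions

/-! ### Coherence computations in a bicategory. -/

section BicategoryLemmas

variable {C : Type*} [Bicategory C] {a b c d : C}

open Bicategory

/-- Used with D = Map_B(X, B), E = Map_B(X, X), l = ℓ_X and the evaluations ev and e; then `h` is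
the defining property of ℓ_X. After whiskering `h` with M, only the interchange law and coherence
remain. -/
lemma whiskerRight_whiskerLeft_evaluation {M : a ⟶ b} {X : b ⟶ c} {D : c ⟶ b} {E : b ⟶ b}
    {R : a ⟶ c} (ev : D ≫ X ⟶ 𝟙 c) (l : X ≫ D ⟶ E) (e : E ≫ X ⟶ X)
    (h : l ▷ X ≫ e = (Bicategory.associator X D X).hom ≫ X ◁ ev ≫ (Bicategory.rightUnitor X).hom) (j : M ≫ X ⟶ R) :
    (M ◁ l) ▷ X ≫ (Bicategory.associator M E X).hom ≫ M ◁ e ≫ j =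
      (Bicategory.associator M X D).inv ▷ X ≫ (j ▷ D) ▷ X ≫ (Bicategory.associator R D X).hom ≫ R ◁ ev ≫ (Bicategory.rightUnitor R).hom := by
  have h₁ : (M ◁ l) ▷ X ≫ (Bicategory.associator M E X).hom ≫ M ◁ e ≫ j =
      (Bicategory.associator M (X ≫ D) X).hom ≫ M ◁ (l ▷ X ≫ e) ≫ j := by simp
  have h₂ : (j ▷ D) ▷ X ≫ (Bicategory.associator R D X).hom ≫ R ◁ ev ≫ (Bicategory.rightUnitor R).hom =
      (Bicategory.associator (M ≫ X) D X).hom ≫ (M ≫ X) ◁ ev ≫ (Bicategory.rightUnitor (M ≫ X)).hom ≫ j := by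
    rw [Bicategory.associator_naturality_left_assoc, ← Bicategory.whisker_exchange_assoc, Bicategory.rightUnitor_naturality]
  rw [h₁, h₂, h]
  simp

/-- The counterpart for u = η_A, where `h` is the defining property of η_A. -/
lemma whiskerRight_whiskerLeft_unit {M : a ⟶ b} {X : b ⟶ c} {E : b ⟶ b} {R : a ⟶ c}
    (u : 𝟙 b ⟶ E) (e : E ≫ X ⟶ X) (h : u ▷ X ≫ e = (Bicategory.leftUnitor X).hom) (j : M ≫ X ⟶ R) :
    (M ◁ u) ▷ X ≫ (Bicategory.associator M E X).hom ≫ M ◁ e ≫ j = (Bicategory.rightUnitor M).hom ▷ X ≫ j := by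
  have h₁ : (M ◁ u) ▷ X ≫ (Bicategory.associator M E X).hom ≫ M ◁ e ≫ j =
      (Bicategory.associator M (𝟙 b) X).hom ≫ M ◁ (u ▷ X ≫ e) ≫ j := by simp
  rw [h₁, h]
  simp

end BicategoryLemmas

lemma comp_hom_eq {V : Type u} [Category.{v} V] [MonoidalCategory V] {A B : Mon V}
    {M N K N' : Bimod A B} {f : M ⟶ N} {g : N ⟶ K} {f' : M ⟶ N'} {g' : N' ⟶ K}
    (h : f ≫ g = f' ≫ g') : f.hom ≫ g.hom = f'.hom ≫ g'.hom :=
  congrArg Bimod.Hom.hom h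

/-! ### Transposes and the assembly map. -/

section Transposes

variable {V : Type u} [Category.{v} V] [MonoidalCategory V] [SymmetricCategory V]
  [MonoidalClosed V] [HasCoequalizers V] {A B C : Mon V}

lemma tensorπ_whiskerLeft (M : Bimod C A) {X X' : Bimod A B} (f : X ⟶ X') :
    tensorπ M X ≫ (Bimod.whiskerLeft M f).hom = M.X ◁ f.hom ≫ tensorπ M X' :=
  ι_colimMap _ _

variable [HasEqualizers V]

lemma comp_transpose {M M' : Bimod C A} {X : Bimod A B} {N : Bimod C B} (p : M ⟶ M')
    (f : M'.tensorBimod X ⟶ N) :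
    p ≫ transpose f = transpose (Bimod.whiskerRight p X ≫ f) :=
  (transposeEquiv M X N).symm.injective <|
    (untranspose_comp p (transpose f)).trans <| by
      rw [show untranspose (transpose f) = f from (transposeEquiv M' X N).left_inv f]
      exact ((transposeEquiv M X N).left_inv _).symm

lemma whiskerRight_transpose {M : Bimod C A} {X : Bimod A B} {N : Bimod C B}
    (f : M.tensorBimod X ⟶ N) :
    Bimod.whiskerRight (transpose f) X ≫ untranspose (𝟙 (mapBimod X N)) = f := by
  rw [← untranspose_comp, Category.comp_id]
  exact (transposeEquiv M X N).left_inv f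

variable (X : Bimod A B)

/-- The map `ℓ_N : N ⊗_B Map_B(X, B) ⟶ Map_B(X, N)` for a bimodule `N`. -/
noncomputable def bimodDualMap (N : Bimod C B) :
    N.tensorBimod (mapBimod X (Bimod.regular B)) ⟶ mapBimod X N :=
  transpose ((Bimod.associatorBimod N (mapBimod X (Bimod.regular B)) X).hom ≫
    Bimod.whiskerLeft N (untranspose (𝟙 _)) ≫ (Bimod.rightUnitorBimod N).hom)

/-- The map `M ⊗_A Map_B(X, X) ⟶ Map_B(X, R)` induced by a map `M ⊗_A X ⟶ R`. -/
noncomputable def assembly {M : Bimod C A} {R : Bimod C B} (j : M.tensorBimod X ⟶ R) :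
    M.tensorBimod (mapBimod X X) ⟶ mapBimod X R :=
  transpose ((Bimod.associatorBimod M (mapBimod X X) X).hom ≫
    Bimod.whiskerLeft M (untranspose (𝟙 _)) ≫ j)

-- Both sides are transposes, so it suffices to compare the maps to R before transposing, in the
-- bicategory of algebras and bimodules.
attribute [local instance] Bimod.monBicategory in
lemma whiskerLeft_bimodDualMap_assembly {M : Bimod C A} {R : Bimod C B}
    (j : M.tensorBimod X ⟶ R) :
    Bimod.whiskerLeft M (bimodDualMap X X) ≫ assembly X j =
      (Bimod.associatorBimod M X (mapBimod X (Bimod.regular B))).inv ≫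
        Bimod.whiskerRight j _ ≫ bimodDualMap X R := by
  rw [assembly, bimodDualMap.eq_def X R, comp_transpose, comp_transpose, comp_transpose]
  congr 1
  exact whiskerRight_whiskerLeft_evaluation (C := Mon V) (M := M) (X := X)
    (untranspose (𝟙 (mapBimod X (Bimod.regular B)))) (bimodDualMap X X)
    (untranspose (𝟙 (mapBimod X X))) (whiskerRight_transpose _) j

attribute [local instance] Bimod.monBicategory in
lemma whiskerLeft_unit_assembly {M : Bimod C A} {R : Bimod C B}
    (j : M.tensorBimod X ⟶ R) :
    Bimod.whiskerLeft M (transpose (Bimod.leftUnitorBimod X).hom) ≫ assembly X j =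
      (Bimod.rightUnitorBimod M).hom ≫ transpose j := by
  rw [assembly, comp_transpose, comp_transpose]
  congr 1
  exact whiskerRight_whiskerLeft_unit (C := Mon V) (M := M) (X := X)
    (transpose (Bimod.leftUnitorBimod X).hom)
    (untranspose (𝟙 (mapBimod X X))) (whiskerRight_transpose _) j

end Transposes

/-! ### Left modules as right modules over the opposite algebra. -/

section Opposite

variable {V : Type u} [Category.{v} V] [MonoidalCategory V]

/-- The left `A`-module given by an object with a left action of `A`. -/
abbrev LeftMod.ofAction {A : Mon V} (M : V) (l : A.X ⊗ M ⟶ M)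
    (hone : η[A.X] ▷ M ≫ l = (λ_ M).hom)
    (hmul : μ[A.X] ▷ M ≫ l = (α_ A.X A.X M).hom ≫ A.X ◁ l ≫ l) : LeftMod A where
  X := M
  actLeft := l
  one_actLeft := hone
  left_assoc := hmul
  actRight := (ρ_ M).hom
  actRight_one := by
    change M ◁ 𝟙 (𝟙_ V) ≫ _ = _
    simp
  right_assoc := by
    change M ◁ (λ_ (𝟙_ V)).hom ≫ _ = (α_ M (𝟙_ V) (𝟙_ V)).inv ≫ _ ▷ 𝟙_ V ≫ _
    monoidal
  middle_assoc := by
    change l ▷ 𝟙_ V ≫ (ρ_ M).hom = (α_ A.X M (𝟙_ V)).hom ≫ A.X ◁ (ρ_ M).hom ≫ l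
    simp

lemma LeftMod.actRight_eq {A : Mon V} (M : LeftMod A) : M.actRight = (ρ_ M.X).hom :=
  (Category.id_comp M.actRight).symm.trans
    ((congrArg (fun k => k ≫ M.actRight) (whiskerLeft_id M.X (𝟙_ V)).symm).trans M.actRight_one)

/-- A map that commutes with the left actions is a morphism of left modules. -/
def LeftMod.homMk {A : Mon V} {M N : LeftMod A} (f : M.X ⟶ N.X)
    (hf : M.actLeft ≫ f = A.X ◁ f ≫ N.actLeft) : M ⟶ N where
  hom := f
  left_act_hom := hf
  right_act_hom := by
    rw [M.actRight_eq, N.actRight_eq]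
    exact (rightUnitor_naturality f).symm

/-- The left `A`-module underlying an `A`-`B`-bimodule. -/
def leftPart {A B : Mon V} (X : Bimod A B) : LeftMod A :=
  LeftMod.ofAction X.X X.actLeft X.one_actLeft X.left_assoc

variable [SymmetricCategory V]

/-- Two ways of reversing three factors; this drives the associativity and balancing computations
below. -/
lemma braiding_reverse (X Y Z : V) :
    (β_ (X ⊗ Y) Z).hom ≫ Z ◁ (β_ X Y).hom ≫ (α_ Z Y X).inv =
      (α_ X Y Z).hom ≫ X ◁ (β_ Y Z).hom ≫ (β_ X (Z ⊗ Y)).hom := by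
  rw [BraidedCategory.braiding_tensor_left_hom, BraidedCategory.braiding_tensor_right_hom]
  simp only [Category.assoc]

lemma braiding_reverse_assoc {X Y Z W : V} (f : (Z ⊗ Y) ⊗ X ⟶ W) :
    (β_ (X ⊗ Y) Z).hom ≫ Z ◁ (β_ X Y).hom ≫ (α_ Z Y X).inv ≫ f =
      (α_ X Y Z).hom ≫ X ◁ (β_ Y Z).hom ≫ (β_ X (Z ⊗ Y)).hom ≫ f := by
  have := congrArg (fun k => k ≫ f) (braiding_reverse X Y Z)
  simpa only [Category.assoc] using this

/-- The opposite algebra. -/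
abbrev opMon (A : Mon V) : Mon V where
  X := A.X
  mon :=
    { one := η[A.X]
      mul := (β_ A.X A.X).hom ≫ μ[A.X]
      one_mul := by
        rw [BraidedCategory.braiding_naturality_left_assoc, MonObj.mul_one]
        simp
      mul_one := by
        rw [BraidedCategory.braiding_naturality_right_assoc, MonObj.one_mul]
        simp
      mul_assoc := by
        rw [comp_whiskerRight_assoc, BraidedCategory.braiding_naturality_left_assoc,
          MonoidalCategory.whiskerLeft_comp_assoc,
          BraidedCategory.braiding_naturality_right_assoc, MonObj.mul_assoc_flip,
          BraidedCategory.braiding_naturality_left_assoc, braiding_reverse_assoc] }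

lemma unit_braiding_right {A P : V} (e : 𝟙_ V ⟶ A) (r : P ⊗ A ⟶ P)
    (h : P ◁ e ≫ r = (ρ_ P).hom) : e ▷ P ≫ (β_ A P).hom ≫ r = (λ_ P).hom := by
  rw [BraidedCategory.braiding_naturality_left_assoc, h]
  simp

lemma unit_braiding_left {A P : V} (e : 𝟙_ V ⟶ A) (l : A ⊗ P ⟶ P)
    (h : e ▷ P ≫ l = (λ_ P).hom) : P ◁ e ≫ (β_ P A).hom ≫ l = (ρ_ P).hom := by
  rw [BraidedCategory.braiding_naturality_right_assoc, h]
  simp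

/-- Keeping m and m' separate lets the same lemma pass from an algebra to its opposite (`hm` is
`rfl`) and back (`hm` is the symmetry of the braiding). -/
lemma mul_braiding_right {A P : V} {m m' : A ⊗ A ⟶ A} (hm : (β_ A A).hom ≫ m' = m)
    (r : P ⊗ A ⟶ P) (h : P ◁ m' ≫ r = (α_ P A A).inv ≫ r ▷ A ≫ r) :
    m ▷ P ≫ (β_ A P).hom ≫ r =
      (α_ A A P).hom ≫ A ◁ ((β_ A P).hom ≫ r) ≫ (β_ A P).hom ≫ r := by
  subst hm
  rw [comp_whiskerRight_assoc, BraidedCategory.braiding_naturality_left_assoc m', h,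
    BraidedCategory.braiding_naturality_left_assoc (β_ A A).hom, braiding_reverse_assoc,
    MonoidalCategory.whiskerLeft_comp_assoc,
    BraidedCategory.braiding_naturality_right_assoc A r]

lemma mul_braiding_left {A P : V} {m m' : A ⊗ A ⟶ A} (hm : (β_ A A).hom ≫ m' = m)
    (l : A ⊗ P ⟶ P) (h : m' ▷ P ≫ l = (α_ A A P).hom ≫ A ◁ l ≫ l) :
    P ◁ m ≫ (β_ P A).hom ≫ l =
      (α_ P A A).inv ≫ ((β_ P A).hom ≫ l) ▷ A ≫ (β_ P A).hom ≫ l := by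
  subst hm
  rw [← cancel_epi (α_ P A A).hom, Iso.hom_inv_id_assoc, MonoidalCategory.whiskerLeft_comp_assoc,
    BraidedCategory.braiding_naturality_right_assoc P m', h, ← braiding_reverse_assoc,
    Iso.inv_hom_id_assoc, comp_whiskerRight_assoc,
    BraidedCategory.braiding_naturality_left_assoc l,
    BraidedCategory.braiding_naturality_left_assoc (β_ P A).hom]

/-- The left action of `A` obtained from a right action of the opposite algebra. -/
abbrev leftModOfOp {A : Mon V} (P : RightMod (opMon A)) : LeftMod A :=
  LeftMod.ofAction P.X ((β_ A.X P.X).hom ≫ P.actRight)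
    (unit_braiding_right _ _ P.actRight_one)
    (mul_braiding_right (SymmetricCategory.symmetry_assoc _ _ _) _ P.right_assoc)

/-- The right action of the opposite algebra obtained from a left action of `A`. -/
def opRightMod {A : Mon V} (L : LeftMod A) : RightMod (opMon A) :=
  RightMod.ofAction L.X ((β_ L.X A.X).hom ≫ L.actLeft)
    (unit_braiding_left _ _ L.one_actLeft)
    (mul_braiding_left rfl _ L.left_assoc)

/-- The left action of the opposite algebra obtained from a right action of `A`. -/
abbrev opLeftMod {A : Mon V} (M : RightMod A) : LeftMod (opMon A) :=
  LeftMod.ofAction M.X ((β_ A.X M.X).hom ≫ M.actRight)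
    (unit_braiding_right _ _ M.actRight_one)
    (mul_braiding_right rfl _ M.right_assoc)

lemma braiding_linear {A P L : V} (f : P ⟶ L) (r : P ⊗ A ⟶ P) (l : A ⊗ L ⟶ L)
    (h : r ≫ f = f ▷ A ≫ (β_ L A).hom ≫ l) : ((β_ A P).hom ≫ r) ≫ f = A ◁ f ≫ l := by
  rw [Category.assoc, h, BraidedCategory.braiding_naturality_left_assoc,
    SymmetricCategory.symmetry_assoc]

/-- A left linear map into `L` from a right module over the opposite algebra. -/
def leftModOfOpHom {A : Mon V} {P : RightMod (opMon A)} {L : LeftMod A} (f : P ⟶ opRightMod L) :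
    leftModOfOp P ⟶ L :=
  LeftMod.homMk f.hom (braiding_linear f.hom P.actRight L.actLeft f.right_act_hom)

/-- A right linear map is left linear over the opposite algebra. -/
def opLeftModMap {A : Mon V} {M N : RightMod A} (f : M ⟶ N) : opLeftMod M ⟶ opLeftMod N :=
  LeftMod.homMk f.hom (by
    rw [Category.assoc, f.right_act_hom, BraidedCategory.braiding_naturality_right_assoc])

/-- Makes the braiding descend to the coequalizers in `tensorSwap`, in both directions. -/
lemma balanced_swap {A M P Z : V} (r : M ⊗ A ⟶ M) (s : P ⊗ A ⟶ P) (k : P ⊗ M ⟶ Z)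
    (h : s ▷ M ≫ k = (α_ P A M).hom ≫ P ◁ ((β_ A M).hom ≫ r) ≫ k) :
    r ▷ P ≫ (β_ M P).hom ≫ k = (α_ M A P).hom ≫ M ◁ ((β_ A P).hom ≫ s) ≫ (β_ M P).hom ≫ k := by
  have h' : P ◁ r ≫ k = P ◁ (β_ M A).hom ≫ (α_ P A M).inv ≫ s ▷ M ≫ k := by
    rw [h, Iso.inv_hom_id_assoc, ← MonoidalCategory.whiskerLeft_comp_assoc,
      SymmetricCategory.symmetry_assoc]
  rw [BraidedCategory.braiding_naturality_left_assoc, h', braiding_reverse_assoc,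
    MonoidalCategory.whiskerLeft_comp_assoc, BraidedCategory.braiding_naturality_right_assoc M s]

variable [MonoidalClosed V] [HasCoequalizers V] {A : Mon V}

/-- The symmetry `M ⊗_A P ≅ P ⊗ M`, where the right-hand tensor product is over the opposite
algebra of `A`. -/
noncomputable def tensorSwap (M : RightMod A) (P : RightMod (opMon A)) :
    (M.tensorBimod (leftModOfOp P)).X ≅ (P.tensorBimod (opLeftMod M)).X where
  hom := tensorDesc (M := M) (X := leftModOfOp P)
    ((β_ M.X P.X).hom ≫ tensorπ P (opLeftMod M))
    (balanced_swap M.actRight P.actRight _ (tensorπ_condition P (opLeftMod M)))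
  inv := tensorDesc (M := P) (X := opLeftMod M)
    ((β_ P.X M.X).hom ≫ tensorπ M (leftModOfOp P))
    (balanced_swap (A := A.X) P.actRight M.actRight _ (tensorπ_condition M (leftModOfOp P)))
  hom_inv_id := by
    apply tensor_hom_ext
    rw [← Category.assoc, tensorπ_desc, Category.assoc, tensorπ_desc]
    exact (SymmetricCategory.symmetry_assoc _ _ _).trans (Category.comp_id _).symm
  inv_hom_id := by
    apply tensor_hom_ext
    rw [← Category.assoc, tensorπ_desc, Category.assoc, tensorπ_desc]
    exact (SymmetricCategory.symmetry_assoc _ _ _).trans (Category.comp_id _).symm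

lemma whiskerRight_tensorSwap {M M' : RightMod A} (f : M ⟶ M') (P : RightMod (opMon A)) :
    (Bimod.whiskerRight f (leftModOfOp P)).hom ≫ (tensorSwap M' P).hom =
      (tensorSwap M P).hom ≫ (Bimod.whiskerLeft P (opLeftModMap f)).hom := by
  apply tensor_hom_ext
  rw [← Category.assoc, tensorπ_whiskerRight, tensorSwap, tensorSwap, Category.assoc, tensorπ_desc,
    ← Category.assoc (tensorπ _ _), tensorπ_desc, Category.assoc, tensorπ_whiskerLeft]
  exact BraidedCategory.braiding_naturality_left_assoc f.hom P.X _

end Opposite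

/-- The diagram chase for `homotopyRightDualizable`: of g and k only the composite is known to be a
weak equivalence. -/
lemma weakEquivalence_of_precomp_of_two_squares {C : Type*} [Category* C]
    [CategoryWithWeakEquivalences C] [(weakEquivalences C).HasTwoOutOfThreeProperty]
    {P P' K K' L L' E N : C} {a : P' ⟶ P} {b : P ⟶ K} {c : P' ⟶ K'} {d : K' ⟶ K} {e : K ⟶ L}
    {f : K' ⟶ L'} {g : L' ⟶ L} {k : L ⟶ E} {l : E ⟶ N} (h₁ : a ≫ b = c ≫ d)
    (h₂ : d ≫ e = f ≫ g) (hgk : WeakEquivalence (g ≫ k)) (hl : WeakEquivalence l)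
    [WeakEquivalence a] [WeakEquivalence c] [WeakEquivalence f] :
    WeakEquivalence (b ≫ e ≫ k ≫ l) := by
  have h : a ≫ b ≫ e ≫ k ≫ l = c ≫ f ≫ (g ≫ k) ≫ l := by
    rw [reassoc_of% h₁, reassoc_of% h₂, Category.assoc]
  exact weakEquivalence_of_precomp_of_fac h

/-! ### Homotopy flatness on either side. -/

section Homotopy

variable {V : Type u} [Category.{v} V] [MonoidalCategory V] [SymmetricCategory V]
  [MonoidalClosed V] [ModelCategory V] {A B C : Mon V}

instance isIso_hom_iso {M N : Bimod A B} (e : M ≅ N) : IsIso e.hom.hom :=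
  inferInstanceAs (IsIso ((Bimod.forget (B := B) A).map e.hom))

instance isIso_inv_iso {M N : Bimod A B} (e : M ≅ N) : IsIso e.inv.hom :=
  inferInstanceAs (IsIso ((Bimod.forget (B := B) A).map e.inv))

/-- The object of `V` underlying M ⊗_A P depends only on the left action on P. -/
lemma HomotopyFlat.whiskerLeft {M : RightMod A} (hM : HomotopyFlat M) {P Q : Bimod A B}
    (f : P ⟶ Q) (hf : WeakEquivalence f.hom) : WeakEquivalence (Bimod.whiskerLeft M f).hom :=
  hM (P := leftPart P) (Q := leftPart Q) (LeftMod.homMk f.hom f.left_act_hom) hf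

/-- A need not be cofibrant over itself, so CHF does not apply; instead A ⊗_A - is naturally the
identity. -/
lemma homotopyFlat_regular (A : Mon V) : HomotopyFlat (rightPart (Bimod.regular A)) := by
  intro P Q f hf
  have h : (Bimod.whiskerLeft (rightPart (Bimod.regular A)) f).hom =
      (Bimod.leftUnitorBimod P).hom.hom ≫ f.hom ≫ (Bimod.leftUnitorBimod Q).inv.hom :=
    congrArg Bimod.Hom.hom (Bimod.id_whiskerLeft_bimod f)
  have h' : WeakEquivalence
      ((Bimod.leftUnitorBimod P).hom.hom ≫ f.hom ≫ (Bimod.leftUnitorBimod Q).inv.hom) :=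
    inferInstance
  rw [h]
  exact h'

/-- A left `A`-module `L` is homotopy flat if `- ⊗_A L`, from right `A`-modules to `V`, preserves
weak equivalences. -/
def LeftHomotopyFlat (L : LeftMod A) : Prop :=
  ∀ {M N : RightMod A} (f : M ⟶ N), WeakEquivalence f.hom →
    WeakEquivalence (Bimod.whiskerRight f L).hom

lemma HomotopyFlat.leftHomotopyFlat {P : RightMod (opMon A)} (hP : HomotopyFlat P) :
    LeftHomotopyFlat (leftModOfOp P) := by
  intro M N f hf
  have : WeakEquivalence (Bimod.whiskerLeft P (opLeftModMap f)).hom := hP _ hf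
  exact weakEquivalence_of_postcomp_of_fac (whiskerRight_tensorSwap f P)

lemma governedAdj_homEquiv {X : Bimod A B} {M : RightMod A} {N : RightMod B}
    (f : (tensorFunctor X).obj M ⟶ N) :
    (governedAdj X).homEquiv M N f = transpose (X := X) f := by
  rw [governedAdj, tensorMapAdj, Adjunction.mkOfHomEquiv_homEquiv]
  rfl

variable [∀ A : Mon V, ModelCategory (RightMod A)]

/-- A cofibrant replacement over the opposite algebra is homotopy flat there, and `tensorSwap`
carries flatness to the left side over A. -/
lemma exists_leftHomotopyFlat (hV : ModuleHypothesis V) (hCHF : CHFHypothesis V)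
    (L : LeftMod A) :
    ∃ (Q : LeftMod A) (q : Q ⟶ L), LeftHomotopyFlat Q ∧ WeakEquivalence q.hom := by
  obtain ⟨P, p, hP, hp⟩ := exists_cofibrant_replacement (opRightMod L)
  exact ⟨leftModOfOp P, leftModOfOpHom p, HomotopyFlat.leftHomotopyFlat (hCHF _ P hP), (hV.right _ p).1 hp⟩

/-- Tensoring with an arbitrary bimodule preserves weak equivalences between homotopy flat right
modules. -/
lemma HomotopyFlat.whiskerRight (hV : ModuleHypothesis V) (hCHF : CHFHypothesis V)
    {M N : RightMod A} (hM : HomotopyFlat M) (hN : HomotopyFlat N) (f : M ⟶ N)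
    (hf : WeakEquivalence f.hom) (X : Bimod A B) :
    WeakEquivalence (Bimod.whiskerRight f X).hom := by
  -- In the square of f ⊗ Q and f ⊗ X, the maps M ⊗ q and N ⊗ q are weak equivalences as M and N are
  -- flat, and f ⊗ Q is one as Q is left flat.
  obtain ⟨Q, q, hQ, hq⟩ := exists_leftHomotopyFlat hV hCHF (leftPart X)
  have h₁ := hM q hq
  have h₂ := hN q hq
  have h₃ := hQ f hf
  have h₄ : WeakEquivalence (Bimod.whiskerRight f (leftPart X)).hom :=
    weakEquivalence_of_precomp_of_fac (comp_hom_eq (Bimod.whisker_exchange_bimod f q))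
  exact h₄

/-! ### The two implications of the theorem. -/

variable (X : Bimod A B)

lemma weakEquivalence_transpose_iff {X : Bimod A B} (h : IsQuillenEquivalence (governedAdj X))
    {M : RightMod A} {N : RightMod B} (hM : IsCofibrant M) (hN : IsFibrant N)
    (f : M.tensorBimod X ⟶ N) : WeakEquivalence f ↔ WeakEquivalence (transpose f) := by
  rw [← governedAdj_homEquiv f]
  exact h.weakEquivalence_iff hM hN f

/-- The evaluation `Map_B(X, N) ⊗_A X ⟶ N` as a map of left modules. -/
noncomputable def leftEv (N : Bimod C B) :
    (mapBimod X N).tensorBimod (leftPart X) ⟶ leftPart N :=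
  LeftMod.homMk (untranspose (𝟙 (mapBimod X N))).hom (untranspose (𝟙 (mapBimod X N))).left_act_hom

/-- For a cofibrant replacement q of A, the map q ⊗ X into A ⊗_A X ≅ X is a weak equivalence between
tensor products of flat modules with X. Its adjoint is q followed by η_A. -/
lemma weakEquivalence_unitMap (hV : ModuleHypothesis V) (hCHF : CHFHypothesis V)
    (hQE : IsQuillenEquivalence (governedAdj X)) (hXf : IsFibrant (rightPart X)) :
    WeakEquivalence (unitMap X).hom := by
  obtain ⟨Q, q, hQ, hq⟩ := exists_cofibrant_replacement (rightPart (Bimod.regular A))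
  rw [hV.right] at hq
  let l : (rightPart (Bimod.regular A)).tensorBimod X ⟶ rightPart X :=
    RightMod.homMk (Bimod.leftUnitorBimod X).hom.hom (Bimod.leftUnitorBimod X).hom.right_act_hom
  have hl : WeakEquivalence l.hom :=
    inferInstanceAs (WeakEquivalence (Bimod.leftUnitorBimod X).hom.hom)
  have h₁ : WeakEquivalence (Bimod.whiskerRight q X).hom :=
    HomotopyFlat.whiskerRight hV hCHF (hCHF _ _ hQ) (homotopyFlat_regular A) q hq X
  have h₂ : WeakEquivalence (Bimod.whiskerRight q X ≫ l) := by
    rw [hV.right, Bimod.comp_hom']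
    infer_instance
  have h₃ : WeakEquivalence (transpose (Bimod.whiskerRight q X ≫ l)) :=
    (weakEquivalence_transpose_iff hQE hQ hXf _).1 h₂
  rw [← comp_transpose, hV.right, Bimod.comp_hom'] at h₃
  exact weakEquivalence_of_precomp q.hom (transpose l).hom

/-- This is the derived counit, computed by resolving X instead of Map_B(X, N). With p : P ⟶
Map_B(X, N) a cofibrant replacement, P ⊗_A Q is weakly equivalent to both P ⊗_A X and Map_B(X, N)
⊗_A Q, and the adjoint P ⊗_A X ⟶ N of p is a weak equivalence. -/
lemma weakEquivalence_leftEv (hV : ModuleHypothesis V) (hCHF : CHFHypothesis V)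
    (hQE : IsQuillenEquivalence (governedAdj X)) {N : RightMod B} (hN : IsFibrant N)
    {Q : LeftMod A} (q : Q ⟶ leftPart X) (hQ : LeftHomotopyFlat Q) (hq : WeakEquivalence q.hom) :
    WeakEquivalence (Bimod.whiskerLeft (mapBimod X N) q ≫ leftEv X N).hom := by
  obtain ⟨P, p, hP, hp⟩ := exists_cofibrant_replacement (mapBimod X N)
  have h₁ : WeakEquivalence (untranspose p) := by
    rw [weakEquivalence_transpose_iff hQE hP hN]
    rwa [show transpose (untranspose p) = p from (transposeEquiv P X N).right_inv p]
  rw [hV.right] at hp h₁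
  have h₂ := hCHF _ P hP q hq
  have h₃ := hQ p hp
  have h₄ : (untranspose p).hom =
      (Bimod.whiskerRight p (leftPart X)).hom ≫ (leftEv X N).hom := by
    have := untranspose_comp p (𝟙 (mapBimod X N))
    rw [Category.comp_id] at this
    exact congrArg Bimod.Hom.hom this
  have h₅ : (Bimod.whiskerRight p Q).hom ≫ (Bimod.whiskerLeft (mapBimod X N) q).hom =
      (Bimod.whiskerLeft P q).hom ≫ (Bimod.whiskerRight p (leftPart X)).hom :=
    (comp_hom_eq (Bimod.whisker_exchange_bimod p q)).symm
  have h₆ : WeakEquivalence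
      ((Bimod.whiskerRight p (leftPart X)).hom ≫ (leftEv X N).hom) := h₄ ▸ h₁
  have h₇ : (Bimod.whiskerRight p Q).hom ≫
      (Bimod.whiskerLeft (mapBimod X N) q ≫ leftEv X N).hom =
      (Bimod.whiskerLeft P q).hom ≫
        (Bimod.whiskerRight p (leftPart X)).hom ≫ (leftEv X N).hom := by
    rw [Bimod.comp_hom', ← Category.assoc, h₅, Category.assoc]
  exact weakEquivalence_of_precomp_of_fac h₇

/-- With p : P ⟶ N ⊗_B D a cofibrant replacement, p followed by ℓ_N is adjoint to P ⊗_A X ⟶ N ⊗_B D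
⊗_A X ⟶ N. Replacing X by Q, this becomes N tensored with the derived counit at B, which the flat
module N keeps a weak equivalence. -/
lemma homotopyRightDualizable (hV : ModuleHypothesis V) (hCHF : CHFHypothesis V)
    (hQE : IsQuillenEquivalence (governedAdj X))
    (hB : IsFibrant (rightPart (Bimod.regular B))) : HomotopyRightDualizable X := by
  intro N hNf hNc
  let D := mapBimod X (Bimod.regular B)
  obtain ⟨Q, q, hQ, hq⟩ := exists_leftHomotopyFlat hV hCHF (leftPart X)
  obtain ⟨P, p, hP, hp⟩ := exists_cofibrant_replacement (N.tensorBimod D)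
  rw [hV.right] at hp
  let φ : (N.tensorBimod D).tensorBimod X ⟶ N := (Bimod.associatorBimod N D X).hom ≫
    Bimod.whiskerLeft N (dualEv X) ≫ (Bimod.rightUnitorBimod N).hom
  -- The derived counit at B as a right module has the same underlying map as this left B-linear
  -- one; linearity allows tensoring with N over B.
  have hev : WeakEquivalence (Bimod.whiskerLeft D q ≫ leftEv X (Bimod.regular B)).hom :=
    weakEquivalence_leftEv X hV hCHF hQE hB q hQ hq
  have h₁ : WeakEquivalence
      (Bimod.whiskerLeft N (Bimod.whiskerLeft D q ≫ leftEv X (Bimod.regular B))).hom :=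
    hCHF _ N hNc _ hev
  have h₂ := hQ p hp
  have h₃ := hCHF _ P hP q hq
  have h₄ : (Bimod.whiskerLeft P q).hom ≫ (Bimod.whiskerRight p (leftPart X)).hom =
      (Bimod.whiskerRight p Q).hom ≫ (Bimod.whiskerLeft (N.tensorBimod D) q).hom :=
    comp_hom_eq (Bimod.whisker_exchange_bimod p q)
  have h₅ : (Bimod.whiskerLeft (N.tensorBimod D) q).hom ≫
      (Bimod.associatorBimod N D (leftPart X)).hom.hom =
      (Bimod.associatorBimod N D Q).hom.hom ≫
        (Bimod.whiskerLeft N (Bimod.whiskerLeft D q)).hom := by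
    apply comp_hom_eq
    rw [Bimod.comp_whiskerLeft_bimod]
    simp
  have h₆ : (Bimod.whiskerLeft N (Bimod.whiskerLeft D q ≫ leftEv X (Bimod.regular B))).hom =
      (Bimod.whiskerLeft N (Bimod.whiskerLeft D q)).hom ≫
        (Bimod.whiskerLeft N (leftEv X (Bimod.regular B))).hom :=
    congrArg Bimod.Hom.hom (Bimod.whiskerLeft_comp_bimod N _ _)
  have hr : WeakEquivalence (Bimod.rightUnitorBimod N).hom.hom := inferInstance
  have hα : WeakEquivalence (Bimod.associatorBimod N D Q).hom.hom := inferInstance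
  have h₇ : WeakEquivalence ((Bimod.whiskerRight p (leftPart X)).hom ≫
      (Bimod.associatorBimod N D (leftPart X)).hom.hom ≫
        (Bimod.whiskerLeft N (leftEv X (Bimod.regular B))).hom ≫
          (Bimod.rightUnitorBimod N).hom.hom) :=
    weakEquivalence_of_precomp_of_two_squares h₄ h₅ (h₆ ▸ h₁) hr
  have h₈ : WeakEquivalence ((Bimod.whiskerRight p X).hom ≫ φ.hom) := h₇
  have h₉ : WeakEquivalence (Bimod.whiskerRight p X ≫ φ) := (hV.right _ _).2 h₈
  have h₁₀ : WeakEquivalence (transpose (Bimod.whiskerRight p X ≫ φ)) :=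
    (weakEquivalence_transpose_iff hQE hP hNf _).1 h₉
  rw [← comp_transpose, hV.right, Bimod.comp_hom'] at h₁₀
  exact (hV.right _ _).2 (weakEquivalence_of_precomp p.hom (transpose φ).hom)

lemma weakEquivalence_transpose (hV : ModuleHypothesis V) (hCHF : CHFHypothesis V)
    (hQ : IsQuillenAdjunction (governedAdj X)) (hXf : IsFibrant (rightPart X))
    (hXc : IsCofibrant (rightPart X)) (hη : WeakEquivalence (unitMap X).hom)
    (hX : HomotopyRightDualizable X) {M : RightMod A} (hM : IsCofibrant M) {R : RightMod B}
    (hR : IsFibrant R) (j : M.tensorBimod X ⟶ R) (hj : Cofibration j)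
    (hj' : WeakEquivalence j) :
    WeakEquivalence (transpose j) := by
  have hMX : IsCofibrant (M.tensorBimod X) := hQ.isCofibrant_obj hM
  -- Cofibrancy of R is needed twice: for ℓ_R to be a weak equivalence, and for R to be flat in
  -- `h₅`.
  have hRc : IsCofibrant R := isCofibrant_of_cofibration j
  rw [hV.right] at hj'
  have hMf : HomotopyFlat M := hCHF _ M hM
  have h₁ : WeakEquivalence (bimodDualMap X X).hom := (hV.right _ _).1 (hX _ hXf hXc)
  have h₂ : WeakEquivalence (bimodDualMap X R).hom := (hV.right _ _).1 (hX _ hR hRc)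
  have h₃ := HomotopyFlat.whiskerLeft hMf (bimodDualMap X X) h₁
  have h₄ := HomotopyFlat.whiskerLeft hMf (unitMap X) hη
  have h₅ := HomotopyFlat.whiskerRight hV hCHF (hCHF _ _ hMX) (hCHF _ _ hRc) j hj'
    (mapBimod X (Bimod.regular B))
  have h₆ : WeakEquivalence (assembly X j).hom := by
    have e := congrArg Bimod.Hom.hom (whiskerLeft_bimodDualMap_assembly X j)
    simp only [Bimod.comp_hom'] at e
    exact weakEquivalence_of_precomp_of_fac e
  have e : (Bimod.whiskerLeft M (unitMap X)).hom ≫ (assembly X j).hom =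
      (Bimod.rightUnitorBimod M).hom.hom ≫ (transpose j).hom :=
    comp_hom_eq (whiskerLeft_unit_assembly X j)
  rw [hV.right]
  exact weakEquivalence_of_precomp_of_fac e.symm

end Homotopy

end HomotopicalMorita

theorem mainTheorem3 {V : Type u} [Category.{v} V] [MonoidalCategory V] [SymmetricCategory V]
    [MonoidalClosed V] [ModelCategory V] [∀ A : Mon V, ModelCategory (HomotopicalMorita.RightMod A)]
    (hV : HomotopicalMorita.ModuleHypothesis V) (hCHF : HomotopicalMorita.CHFHypothesis V)
    (A B : Mon V) (X : Bimod A B)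
    (hQ : HomotopicalMorita.IsQuillenAdjunction (HomotopicalMorita.governedAdj X))
    (hB : IsFibrant (HomotopicalMorita.rightPart (Bimod.regular B)))
    (hXf : IsFibrant (HomotopicalMorita.rightPart X))
    (hXc : IsCofibrant (HomotopicalMorita.rightPart X)) :
    HomotopicalMorita.IsQuillenEquivalence (HomotopicalMorita.governedAdj X) ↔
      WeakEquivalence (HomotopicalMorita.unitMap X).hom ∧
      HomotopicalMorita.HomotopyCofaithful X ∧
      HomotopicalMorita.HomotopyRightDualizable X := by
  refine ⟨fun h => ⟨HomotopicalMorita.weakEquivalence_unitMap X hV hCHF h hXf,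
    fun hM hN f hf => h.reflects hM hN f ((hV.right _ _).2 hf),
    HomotopicalMorita.homotopyRightDualizable X hV hCHF h hB⟩, fun ⟨hη, hc, hd⟩ => ?_⟩
  refine hQ.isQuillenEquivalence (fun hK hL f hf => hc hK hL f ((hV.right _ _).1 hf)) ?_
  intro K R hK hR j hj hj'
  have := HomotopicalMorita.weakEquivalence_transpose X hV hCHF hQ hXf hXc hη hd hK hR j hj hj'
  rwa [← HomotopicalMorita.governedAdj_homEquiv] at this
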